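/- Let $(X_j)_{j\ge 1}$ be pairwise uncorrelated zero-mean random processes on $[0,1]$, defined on one probability space, with finite second moments and with one and the same continuous covariance function $\mathcal K(t,s)=\mathrm{cov}(X_j(t),X_j(s))$, $t,s\in[0,1]$; uncorrelated means $\mathrm{cov}(X_j(t),X_k(s))=0$ for all $j\ne k$ and all $t,s\in[0,1]$. For $d\ge 1$ and $t=(t_1,\dots,t_d)\in[0,1]^d$ put $$Y_d(t)=\sum_{j=1}^d X_j(t_j),\qquad \widetilde J_d(t)=\sum_{j=1}^d\frac{\sum_{l=1}^d X_j(t_l)}{d},\qquad \widetilde Z_d(t)=\sum_{j=1}^d\Bigl(X_j(t_j)-\frac{\sum_{l=1}^d X_j(t_l)}{d}\Bigr),$$ so that $Y_d=\widetilde J_d+\widetilde Z_d$. For a random field $V$ on $[0,1]^d$ let $K^V$ be its covariance operator on $L_2([0,1]^d)$, $(K^Vf)(t)=\int_{[0,1]^d}\mathrm{cov}(V(t),V(s))f(s)\,ds$, let $(\lambda^V_k)_{k\in\mathbb N}$ be the non-increasing sequence of its eigenvalues, in which every non-zero eigenvalue is repeated according to its multiplicity (and $\lambda^V_k=0$ for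 $k>p$ if $K^V$ has finite rank $p$), and let $(\psi^V_k)$ be a corresponding sequence of eigenvectors, orthonormal over those $k$ with $\lambda^V_k\neq0$. Put $$\mathcal S(V)=\{(\lambda^V_k,\psi^V_k):\lambda^V_k\ne 0,\ k\in\mathbb N\};$$ this set depends on the choice of the eigenvectors. Then for every $d\ge 1$ and every choice of the eigenvectors of $K^{\widetilde J_d}$ and of $K^{\widetilde Z_d}$: 1) $\mathcal S(\widetilde J_d)\cap\mathcal S(\widetilde Z_d)=\varnothing$; 2) $\mathcal S(Y_d)=\mathcal S(\widetilde J_d)\cup\mathcal S(\widetilde Z_d)$ for a suitable choice of the eigenvectors of $K^{Y_d}$; that is, $\mathcal S(\widetilde J_d)\cup\mathcal S(\widetilde Z_d)$ is the set $\{(\lambda_k,\psi_k):\lambda_k\ne0\}$ formed from the non-increasing sequence of eigenvalues of $K^{Y_d}$, with multiplicity, and a corresponding orthonormal sequence of eigenvectors. -/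

import Mathlib

open MeasureTheory ProbabilityTheory

noncomputable section

/-- The additive random field `Y_d(t) = ∑_j X_j(t_j)`, `t ∈ [0,1]^d`. The summands are numbered from
`0`, so that `Y_d` uses `X 0, …, X (d - 1)`. -/
def fieldY {Ω : Type*} (X : ℕ → unitInterval → Ω → ℝ) (d : ℕ) :
    (Fin d → unitInterval) → Ω → ℝ :=
  fun t ω => ∑ j : Fin d, X j (t j) ω

/-- The symmetrised average part `J̃_d(t) = ∑_j (∑_l X_j(t_l)) / d`. -/
def fieldJ {Ω : Type*} (X : ℕ → unitInterval → Ω → ℝ) (d : ℕ) :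
    (Fin d → unitInterval) → Ω → ℝ :=
  fun t ω => ∑ j : Fin d, (∑ l : Fin d, X j (t l) ω) / (d : ℝ)

/-- The remaining part `Z̃_d(t) = ∑_j (X_j(t_j) - (∑_l X_j(t_l)) / d)`. -/
def fieldZ {Ω : Type*} (X : ℕ → unitInterval → Ω → ℝ) (d : ℕ) :
    (Fin d → unitInterval) → Ω → ℝ :=
  fun t ω => ∑ j : Fin d, (X j (t j) ω - (∑ l : Fin d, X j (t l) ω) / (d : ℝ))

/-- The space `L_2([0,1]^d)` with respect to Lebesgue measure. -/
abbrev L2Cube (d : ℕ) : Type :=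
  Lp ℝ 2 (volume : Measure (Fin d → unitInterval))

/-- The covariance function `𝒦^V(t,s) = cov(V(t), V(s))` of a random field `V`. -/
def covFun {Ω T : Type*} [MeasurableSpace Ω] (P : Measure Ω) (V : T → Ω → ℝ) (t s : T) : ℝ :=
  cov[V t, V s; P]

/-- The covariance operator of a random field on `[0,1]^d`: the integral operator
`(K^V f)(t) = ∫ 𝒦^V(t,s) f(s) ds`. -/
def covOp {Ω : Type*} [MeasurableSpace Ω] (P : Measure Ω) {d : ℕ}
    (V : (Fin d → unitInterval) → Ω → ℝ) (f : (Fin d → unitInterval) → ℝ) :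
    (Fin d → unitInterval) → ℝ :=
  fun t => ∫ s, covFun P V t s * f s

/-- `K^V f = μ f` as an identity in `L_2([0,1]^d)`. -/
def EigenEq {Ω : Type*} [MeasurableSpace Ω] (P : Measure Ω) {d : ℕ}
    (V : (Fin d → unitInterval) → Ω → ℝ) (μ : ℝ) (f : L2Cube d) : Prop :=
  covOp P V f =ᵐ[volume] fun t => μ * f t

/-- `lam` is the non-increasing sequence of eigenvalues of `K^V` and `ψ` a corresponding sequence of
orthonormal eigenvectors: every non-zero eigenvalue is listed with its multiplicity, and `lam` is
continued by zeros if `K^V` has finite rank. Nothing is asked of `ψ k` when `lam k = 0`. -/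
structure IsEigenSequence {Ω : Type*} [MeasurableSpace Ω] (P : Measure Ω) {d : ℕ}
    (V : (Fin d → unitInterval) → Ω → ℝ) (lam : ℕ → ℝ) (ψ : ℕ → L2Cube d) : Prop where
  antitone : Antitone lam
  eigen : ∀ k, lam k ≠ 0 → EigenEq P V (lam k) (ψ k)
  orthonormal : Orthonormal ℝ (fun k : {k : ℕ // lam k ≠ 0} => ψ k)
  complete : ∀ (μ : ℝ) (f : L2Cube d), μ ≠ 0 → EigenEq P V μ f →
    f ∈ Submodule.span ℝ (ψ '' {k | lam k = μ})

/-- `S` is a set `𝒮(V) = {(λ_k, ψ_k) : λ_k ≠ 0, k ∈ ℕ}` of eigenpairs of the covariance operator of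
`V`, for some choice of the orthonormal eigenvectors `ψ_k`. -/
def IsEigenpairSet {Ω : Type*} [MeasurableSpace Ω] (P : Measure Ω) {d : ℕ}
    (V : (Fin d → unitInterval) → Ω → ℝ) (S : Set (ℝ × L2Cube d)) : Prop :=
  ∃ (lam : ℕ → ℝ) (ψ : ℕ → L2Cube d), IsEigenSequence P V lam ψ ∧
    S = {p | ∃ k, lam k ≠ 0 ∧ p = (lam k, ψ k)}

end

/-! Write `Y`, `J`, `Z` for the three fields. Since the processes are uncorrelated with common
covariance `𝒦`, both `cov(Y(t), J(s))` and `cov(J(t), J(s))` equal `(1/d) ∑ 𝒦(t_l, s_m)` over all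
`l`, `m`. Hence `Z = Y - J` is uncorrelated with `J`, and `K^Y = K^J + K^Z`.

Both products of `K^J` and `K^Z` vanish. In each argument the kernel of `J` is a symmetric sum `∑
g(u_m)`, while that of `Z` is a diagonal sum `∑ f_j(u_j)` minus its average over index pairs.
Permuting coordinates shows that these are orthogonal (`integral_diagonal_sub_average_mul_eq_zero`).

So each operator kills the other's eigenvectors for non-zero eigenvalues, and the two eigensystems
are orthogonal and together exhaust that of the sum
(`isEigenpairSet_union_of_kernelOp_comp_eq_zero`). Merging them into one non-increasing sequence
uses that the eigenvalues are positive and accumulate only at zero. -/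

/-- Families of positive reals with finite superlevel sets can be rearranged in
non-increasing order. -/
theorem exists_antitone_rearrangement {ι : Type*} [LinearOrder ι] (v : ι → ℝ)
    (hpos : ∀ i, 0 < v i) (hfin : ∀ ε > 0, {i | ε ≤ v i}.Finite) :
    ∃ (lam : ℕ → ℝ) (e : ι → ℕ), Function.Injective e ∧ Antitone lam ∧ (∀ i, lam (e i) = v i) ∧
      ∀ k, lam k ≠ 0 → k ∈ Set.range e := by
  classical
  -- Decreasing value, ties broken by the order of `ι`; the new position of `i` is the number of
  -- keys below its own.
  let key : ι → ℝ ×ₗ ι := fun i => toLex (-v i, i)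
  have key_inj : Function.Injective key := fun i j h => congrArg Prod.snd (toLex.injective h)
  have key_le : ∀ {i j}, key i ≤ key j → v j ≤ v i := fun {i j} h => by
    rcases Prod.Lex.toLex_le_toLex.1 h with h | h
    · exact (neg_lt_neg_iff.1 h).le
    · exact (neg_inj.1 h.1).ge
  have below_fin : ∀ i, {j | key j < key i}.Finite := fun i =>
    (hfin (v i) (hpos i)).subset fun j hj => key_le (le_of_lt hj)
  let below : ι → Finset ι := fun i => (below_fin i).toFinset
  have mem_below : ∀ {i j}, j ∈ below i ↔ key j < key i := fun {i j} => by simp [below]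
  let e : ι → ℕ := fun i => (below i).card
  have e_lt : ∀ {i j}, key i < key j → e i < e j := fun {i j} h =>
    Finset.card_lt_card <| Finset.ssubset_iff_of_subset
      (fun k hk => mem_below.2 ((mem_below.1 hk).trans h)) |>.2
      ⟨i, mem_below.2 h, fun hi => lt_irrefl _ (mem_below.1 hi)⟩
  have e_inj : Function.Injective e := fun i j h => by
    rcases lt_trichotomy (key i) (key j) with h' | h' | h'
    · exact absurd h (e_lt h').ne
    · exact key_inj h'
    · exact absurd h (e_lt h').ne'
  have e_le : ∀ {i j}, e i ≤ e j → v j ≤ v i := fun {i j} h =>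
    key_le (not_lt.1 fun h' => absurd h (e_lt h').not_ge)
  -- The `e i` predecessors of `i` inject into `{0, …, e i - 1}`, hence fill it: the range of `e`
  -- has no gaps, so zeros occur only after all values.
  have e_lower : ∀ i k, k < e i → k ∈ Set.range e := fun i k hk => by
    obtain ⟨j, -, hj⟩ := Finset.surjOn_of_injOn_of_card_le (s := below i)
      (t := Finset.range (e i)) e
      (fun j hj => by simpa using e_lt (mem_below.1 hj)) e_inj.injOn (by simp [e])
      (show k ∈ (Finset.range (e i) : Set ℕ) by simpa using hk)
    exact ⟨j, hj⟩
  have hlam : ∀ i, Function.extend e v 0 (e i) = v i := fun i => e_inj.extend_apply _ _ _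
  refine ⟨Function.extend e v 0, e, e_inj, fun k m hkm => ?_, hlam, fun k hk => ?_⟩
  · by_cases hm : m ∈ Set.range e
    · obtain ⟨j, rfl⟩ := hm
      obtain ⟨i, rfl⟩ : k ∈ Set.range e := by
        rcases hkm.lt_or_eq with h | h
        · exact e_lower j k h
        · exact ⟨j, h.symm⟩
      rw [hlam, hlam]
      exact e_le hkm
    · rw [Function.extend_apply' _ _ _ hm]
      by_cases hk : k ∈ Set.range e
      · obtain ⟨i, rfl⟩ := hk
        rw [hlam]
        exact (hpos i).le
      · rw [Function.extend_apply' _ _ _ hk]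
        exact le_rfl
  · by_contra h
    exact hk (Function.extend_apply' _ _ _ h)

/-! ### Integral operators with continuous kernels -/

section Kernel

variable {T : Type*} [TopologicalSpace T] [CompactSpace T] [MeasurableSpace T] [BorelSpace T]
  {μ : Measure T} [IsFiniteMeasure μ]

/-- The integral operator on `L²` with a continuous kernel on a compact space. -/
noncomputable def kernelOp (μ : Measure T) [IsFiniteMeasure μ] (K : C(T × T, ℝ)) :
    Lp ℝ 2 μ →ₗ[ℝ] Lp ℝ 2 μ where
  toFun f := ContinuousMap.toLp 2 μ ℝ
    ⟨fun t => inner ℝ (ContinuousMap.toLp 2 μ ℝ (K.curry t)) f, by fun_prop⟩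
  map_add' f g := by
    rw [← map_add]
    congr 1
    ext t
    simp [inner_add_right]
  map_smul' c f := by
    rw [RingHom.id_apply, ← map_smul]
    congr 1
    ext t
    simp [inner_smul_right]

theorem inner_toLp_curry (K : C(T × T, ℝ)) (t : T) (f : Lp ℝ 2 μ) :
    inner ℝ (ContinuousMap.toLp 2 μ ℝ (K.curry t)) f = ∫ s, K (t, s) * f s ∂μ := by
  rw [L2.inner_def]
  refine integral_congr_ae ?_
  filter_upwards [ContinuousMap.coeFn_toLp (p := 2) (𝕜 := ℝ) μ (K.curry t)] with s hs
  rw [hs]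
  simp [mul_comm]

theorem kernelOp_coeFn_inner (K : C(T × T, ℝ)) (f : Lp ℝ 2 μ) :
    kernelOp μ K f =ᵐ[μ] fun t => inner ℝ (ContinuousMap.toLp 2 μ ℝ (K.curry t)) f :=
  ContinuousMap.coeFn_toLp μ _

theorem kernelOp_coeFn (K : C(T × T, ℝ)) (f : Lp ℝ 2 μ) :
    kernelOp μ K f =ᵐ[μ] fun t => ∫ s, K (t, s) * f s ∂μ := by
  filter_upwards [kernelOp_coeFn_inner K f] with t ht
  rw [ht, inner_toLp_curry]

theorem kernelOp_isSymmetric [SecondCountableTopology T] (K : C(T × T, ℝ))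
    (hK : ∀ t s, K (t, s) = K (s, t)) :
    (kernelOp μ K).IsSymmetric := by
  have key : ∀ f g : Lp ℝ 2 μ,
      inner ℝ (kernelOp μ K f) g = ∫ t, ∫ s, K (t, s) * (f s * g t) ∂μ ∂μ := fun f g => by
    rw [L2.inner_def]
    refine integral_congr_ae ?_
    filter_upwards [kernelOp_coeFn K f] with t ht
    simp only [ht, ← mul_assoc, integral_mul_const]
    simp [mul_comm]
  intro f g
  rw [key, real_inner_comm (kernelOp μ K g) f, key, integral_integral_swap]
  · refine integral_congr_ae (.of_forall fun t => integral_congr_ae (.of_forall fun s => ?_))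
    simp only [hK s t]
    ring
  · have hf : Integrable f μ := (Lp.memLp f).integrable one_le_two
    have hg : Integrable g μ := (Lp.memLp g).integrable one_le_two
    refine ((hg.mul_prod hf).bdd_mul (c := ‖K‖) K.continuous.aestronglyMeasurable
      (.of_forall fun x => K.norm_coe_le_norm x)).congr (.of_forall fun x => ?_)
    simp only [Function.uncurry, mul_comm (g x.1)]

/-- By symmetry of `L`, `(K L f)(t) = ⟨K(t,·), L f⟩ = ⟨L K(t,·), f⟩`, and `h` says that `L` kills
every row of `K`. -/
theorem kernelOp_comp_eq_zero [SecondCountableTopology T] {K L : C(T × T, ℝ)}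
    (hL : ∀ t s, L (t, s) = L (s, t))
    (h : ∀ s t, ∫ u, L (s, u) * K (t, u) ∂μ = 0) (f : Lp ℝ 2 μ) :
    kernelOp μ K (kernelOp μ L f) = 0 := by
  refine Lp.ext ?_
  filter_upwards [kernelOp_coeFn_inner K (kernelOp μ L f), Lp.coeFn_zero ℝ 2 μ] with t ht h0
  have hrow : kernelOp μ L (ContinuousMap.toLp 2 μ ℝ (K.curry t)) = 0 := by
    refine Lp.ext ?_
    filter_upwards [kernelOp_coeFn L (ContinuousMap.toLp 2 μ ℝ (K.curry t)),
      Lp.coeFn_zero ℝ 2 μ] with s hs h0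
    rw [hs, h0, Pi.zero_apply, ← h s t]
    refine integral_congr_ae ?_
    filter_upwards [ContinuousMap.coeFn_toLp (p := 2) (𝕜 := ℝ) μ (K.curry t)] with u hu
    simp only [hu, ContinuousMap.curry_apply]
  rw [ht, h0, Pi.zero_apply, ← kernelOp_isSymmetric L hL, hrow, inner_zero_left]

/-- Square summability of eigenvalues, by Bessel's inequality. -/
theorem finite_setOf_le_abs_eigenvalue {ι : Type*} (K : C(T × T, ℝ)) {lam : ι → ℝ}
    {ψ : ι → Lp ℝ 2 μ} (hψ : Orthonormal ℝ ψ) (h : ∀ i, kernelOp μ K (ψ i) = lam i • ψ i)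
    {ε : ℝ} (hε : 0 < ε) : {i | ε ≤ |lam i|}.Finite := by
  obtain ⟨C, hC⟩ : ∃ C : ℝ, ∀ t, ‖ContinuousMap.toLp 2 μ ℝ (K.curry t)‖ ^ 2 ≤ C := by
    have hc : Continuous fun t => ‖ContinuousMap.toLp 2 μ ℝ (K.curry t)‖ ^ 2 := by fun_prop
    obtain ⟨C, hC⟩ := (isCompact_range hc).bddAbove
    exact ⟨C, fun t => hC ⟨t, rfl⟩⟩
  -- Bessel for the row `K(t,·)` gives `∑ (lam i * ψ i t)² ≤ ‖K(t,·)‖² ≤ C` for almost every `t`;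
  -- integrate over `t`.
  have hsum : ∀ F : Finset ι, ∑ i ∈ F, lam i ^ 2 ≤ ∫ _, C ∂μ := fun F => by
    have hint : ∀ i, Integrable (fun t => kernelOp μ K (ψ i) t ^ 2) μ := fun i =>
      (Lp.memLp _).integrable_sq
    have hi : ∀ i, lam i ^ 2 = ∫ t, kernelOp μ K (ψ i) t ^ 2 ∂μ := fun i => by
      have h1 : inner ℝ (kernelOp μ K (ψ i)) (kernelOp μ K (ψ i)) = lam i ^ 2 := by
        rw [h i, real_inner_self_eq_norm_sq, norm_smul, hψ.1 i]
        simp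
      rw [← h1, L2.inner_def]
      refine integral_congr_ae (.of_forall fun t => ?_)
      simp [sq]
    simp_rw [hi]
    rw [← integral_finsetSum F fun i _ => hint i]
    refine integral_mono_ae (integrable_finsetSum F fun i _ => hint i) (integrable_const C) ?_
    have hae : ∀ᵐ t ∂μ, ∀ i ∈ F, kernelOp μ K (ψ i) t
        = inner ℝ (ContinuousMap.toLp 2 μ ℝ (K.curry t)) (ψ i) :=
      (Finset.eventually_all F).2 fun i _ => kernelOp_coeFn_inner K (ψ i)
    filter_upwards [hae] with t ht
    refine le_trans (le_of_eq ?_) ((hψ.sum_inner_products_le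
      (ContinuousMap.toLp 2 μ ℝ (K.curry t)) (s := F)).trans (hC t))
    refine Finset.sum_congr rfl fun i hi => ?_
    rw [ht i hi, real_inner_comm, Real.norm_eq_abs, sq_abs]
  have hs : Summable fun i => lam i ^ 2 :=
    summable_of_sum_le (fun i => sq_nonneg _) hsum
  have := hs.tendsto_cofinite_zero.eventually (gt_mem_nhds (pow_pos hε 2))
  refine (Filter.eventually_cofinite.1 this).subset fun i hi => ?_
  rw [Set.mem_ofPred_eq, not_lt, ← sq_abs (lam i)]
  exact pow_le_pow_left₀ hε.le hi 2

end Kernel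

/-! ### Eigensequences and their union -/

section EigenSequence

variable {Ω : Type*} [MeasurableSpace Ω] {P : Measure Ω} {d : ℕ}
  {V : (Fin d → unitInterval) → Ω → ℝ} {K : C((Fin d → unitInterval) × (Fin d → unitInterval), ℝ)}

theorem eigenEq_iff_kernelOp (hV : ∀ t s, covFun P V t s = K (t, s)) (μ : ℝ) (f : L2Cube d) :
    EigenEq P V μ f ↔ kernelOp volume K f = μ • f := by
  have h1 : kernelOp volume K f =ᵐ[volume] covOp P V f := by
    filter_upwards [kernelOp_coeFn K f] with t ht
    rw [ht, covOp]
    simp only [hV]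
  rw [EigenEq, Lp.ext_iff]
  have h2 : (μ • f : L2Cube d) =ᵐ[volume] fun t => μ * f t := Lp.coeFn_smul μ f
  exact ⟨fun h => (h1.trans h).trans h2.symm, fun h => (h1.symm.trans h).trans h2⟩

theorem IsEigenSequence.finite_le_abs (hV : ∀ t s, covFun P V t s = K (t, s)) {lam : ℕ → ℝ}
    {ψ : ℕ → L2Cube d} (h : IsEigenSequence P V lam ψ) {ε : ℝ} (hε : 0 < ε) :
    {k : {k // lam k ≠ 0} | ε ≤ |lam k|}.Finite :=
  finite_setOf_le_abs_eigenvalue K h.orthonormal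
    (fun k => (eigenEq_iff_kernelOp hV _ _).1 (h.eigen k k.2)) hε

/-- Monotonicity replaces positive semidefiniteness: after a negative term all later ones stay below
it, giving infinitely many eigenvalues bounded away from zero. -/
theorem IsEigenSequence.nonneg (hV : ∀ t s, covFun P V t s = K (t, s)) {lam : ℕ → ℝ}
    {ψ : ℕ → L2Cube d} (h : IsEigenSequence P V lam ψ) (k : ℕ) : 0 ≤ lam k := by
  by_contra! hk
  have hle : ∀ m, lam (k + m) ≤ lam k := fun m => h.antitone (Nat.le_add_right k m)
  let g : ℕ → {k // lam k ≠ 0} := fun m => ⟨k + m, ((hle m).trans_lt hk).ne⟩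
  have hg : Function.Injective g := fun a b hab =>
    Nat.add_left_cancel (congrArg Subtype.val hab)
  refine Set.infinite_of_injective_forall_mem hg (fun m => ?_)
    (h.finite_le_abs hV (abs_pos.2 hk.ne))
  change |lam k| ≤ |lam (k + m)|
  rw [abs_of_neg hk, abs_of_neg ((hle m).trans_lt hk)]
  exact neg_le_neg (hle m)

variable {A B : (Fin d → unitInterval) → Ω → ℝ}
  {KA KB : C((Fin d → unitInterval) × (Fin d → unitInterval), ℝ)}

/-- Eigenpairs of two covariance operators with vanishing product are distinct, and together they
are the eigenpairs of the sum. -/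
theorem isEigenpairSet_union_of_kernelOp_comp_eq_zero
    (hA : ∀ t s, covFun P A t s = KA (t, s)) (hB : ∀ t s, covFun P B t s = KB (t, s))
    (hV : ∀ t s, covFun P V t s = KA (t, s) + KB (t, s))
    (hAB : ∀ f : L2Cube d, kernelOp volume KA (kernelOp volume KB f) = 0)
    (hBA : ∀ f : L2Cube d, kernelOp volume KB (kernelOp volume KA f) = 0)
    {SA SB : Set (ℝ × L2Cube d)} (hSA : IsEigenpairSet P A SA) (hSB : IsEigenpairSet P B SB) :
    SA ∩ SB = ∅ ∧ IsEigenpairSet P V (SA ∪ SB) := by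
  obtain ⟨a, φ, ha, rfl⟩ := hSA
  obtain ⟨b, χ, hb, rfl⟩ := hSB
  have hAsymm : (kernelOp volume KA).IsSymmetric := kernelOp_isSymmetric KA fun t s => by
    rw [← hA, ← hA, covFun, covFun, covariance_comm]
  have hV' : ∀ t s, covFun P V t s = (KA + KB) (t, s) := hV
  have hadd : ∀ f : L2Cube d,
      kernelOp volume (KA + KB) f = kernelOp volume KA f + kernelOp volume KB f := fun f => by
    refine Lp.ext ?_
    filter_upwards [kernelOp_coeFn_inner (KA + KB) f, kernelOp_coeFn_inner KA f,
      kernelOp_coeFn_inner KB f, Lp.coeFn_add (kernelOp volume KA f) (kernelOp volume KB f)]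
      with t h h1 h2 h3
    rw [h, h3, Pi.add_apply, h1, h2, ← inner_add_left, ← map_add]
    rfl
  have hAφ : ∀ k, a k ≠ 0 → kernelOp volume KA (φ k) = a k • φ k := fun k hk =>
    (eigenEq_iff_kernelOp hA _ _).1 (ha.eigen k hk)
  have hBχ : ∀ k, b k ≠ 0 → kernelOp volume KB (χ k) = b k • χ k := fun k hk =>
    (eigenEq_iff_kernelOp hB _ _).1 (hb.eigen k hk)
  have hBφ : ∀ k, a k ≠ 0 → kernelOp volume KB (φ k) = 0 := fun k hk => by
    have := hBA (φ k)
    rw [hAφ k hk, map_smul] at this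
    exact (smul_eq_zero.1 this).resolve_left hk
  have hAχ : ∀ k, b k ≠ 0 → kernelOp volume KA (χ k) = 0 := fun k hk => by
    have := hAB (χ k)
    rw [hBχ k hk, map_smul] at this
    exact (smul_eq_zero.1 this).resolve_left hk
  have horth : ∀ k m, a k ≠ 0 → b m ≠ 0 → inner ℝ (φ k) (χ m) = 0 := fun k m hk hm => by
    have := hAsymm (φ k) (χ m)
    rw [hAφ k hk, hAχ m hm, inner_zero_right, real_inner_smul_left] at this
    exact (mul_eq_zero.1 this).resolve_left hk
  refine ⟨?_, ?_⟩
  · refine Set.eq_empty_of_forall_notMem ?_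
    rintro _ ⟨⟨k, hk, rfl⟩, m, hm, h⟩
    -- A common eigenpair would be a unit vector orthogonal to itself.
    have hφχ : φ k = χ m := congrArg Prod.snd h
    have h1 : ‖χ m‖ = 1 := hb.orthonormal.1 ⟨m, hm⟩
    have h0 := horth k m hk hm
    rw [hφχ, real_inner_self_eq_norm_sq, h1] at h0
    norm_num at h0
  -- The lexicographic sum supplies the linear order needed for breaking ties.
  let v : {k // a k ≠ 0} ⊕ₗ {k // b k ≠ 0} → ℝ := fun i =>
    Sum.elim (fun k => a k.1) (fun k => b k.1) (ofLex i)
  let w : {k // a k ≠ 0} ⊕ₗ {k // b k ≠ 0} → L2Cube d := fun i =>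
    Sum.elim (fun k => φ k.1) (fun k => χ k.1) (ofLex i)
  have hvpos : ∀ i, 0 < v i := by
    rintro (k | k)
    · exact lt_of_le_of_ne (ha.nonneg hA k) k.2.symm
    · exact lt_of_le_of_ne (hb.nonneg hB k) k.2.symm
  have hvfin : ∀ ε > 0, {i | ε ≤ v i}.Finite := fun ε hε => by
    refine (((ha.finite_le_abs hA hε).image (fun k => toLex (Sum.inl k))).union
      ((hb.finite_le_abs hB hε).image (fun k => toLex (Sum.inr k)))).subset ?_
    rintro (k | k) hk
    · exact Or.inl ⟨k, show ε ≤ |_| from le_trans hk (le_abs_self _), rfl⟩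
    · exact Or.inr ⟨k, show ε ≤ |_| from le_trans hk (le_abs_self _), rfl⟩
  have hworth : Orthonormal ℝ w := by
    refine ⟨?_, ?_⟩
    · rintro (k | k)
      · exact ha.orthonormal.1 k
      · exact hb.orthonormal.1 k
    · rintro (k | k) (m | m) hkm
      · exact ha.orthonormal.2 fun h => hkm (by rw [h])
      · exact horth k m k.2 m.2
      · exact (real_inner_comm _ _).trans (horth m k m.2 k.2)
      · exact hb.orthonormal.2 fun h => hkm (by rw [h])
  obtain ⟨lam, e, e_inj, lam_anti, lam_e, mem_range⟩ :=
    exists_antitone_rearrangement v hvpos hvfin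
  let ψ : ℕ → L2Cube d := Function.extend e w 0
  have hψ : ∀ i, ψ (e i) = w i := fun i => e_inj.extend_apply _ _ _
  have hlam : ∀ i, lam (e i) ≠ 0 := fun i => (lam_e i).trans_ne (hvpos i).ne'
  refine ⟨lam, ψ, ⟨lam_anti, fun k hk => ?_, ?_, fun μ f hμ hf => ?_⟩, ?_⟩
  · obtain ⟨i, rfl⟩ := mem_range k hk
    rw [eigenEq_iff_kernelOp hV', hψ, lam_e, hadd]
    rcases i with k | k
    · change kernelOp volume KA (φ k) + kernelOp volume KB (φ k) = a k • φ k
      rw [hAφ k k.2, hBφ k k.2, add_zero]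
    · change kernelOp volume KA (χ k) + kernelOp volume KB (χ k) = b k • χ k
      rw [hAχ k k.2, hBχ k k.2, zero_add]
  · choose r hr using fun k : {k // lam k ≠ 0} => mem_range k k.2
    have hr_inj : Function.Injective r := fun k m h => Subtype.ext (by rw [← hr, ← hr, h])
    convert hworth.comp r hr_inj using 1
    ext1 k
    rw [← hr, hψ, Function.comp]
  · rw [eigenEq_iff_kernelOp hV', hadd] at hf
    -- Applying `KA` to `KA f + KB f = μ f` shows that `KA f` solves the eigenequation of `KA` for
    -- `μ`; likewise for `KB`. Then `f = μ⁻¹ (KA f + KB f)`.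
    have hfA : kernelOp volume KA f ∈ Submodule.span ℝ (φ '' {k | a k = μ}) := by
      refine ha.complete μ _ hμ ((eigenEq_iff_kernelOp hA _ _).2 ?_)
      rw [← map_smul, ← hf, map_add, hAB, add_zero]
    have hfB : kernelOp volume KB f ∈ Submodule.span ℝ (χ '' {k | b k = μ}) := by
      refine hb.complete μ _ hμ ((eigenEq_iff_kernelOp hB _ _).2 ?_)
      rw [← map_smul, ← hf, map_add, hBA, zero_add]
    rw [← inv_smul_smul₀ hμ f, ← hf]
    refine Submodule.smul_mem _ _ (Submodule.add_mem _ (Submodule.span_mono ?_ hfA)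
      (Submodule.span_mono ?_ hfB))
    · rintro _ ⟨k, rfl, rfl⟩
      exact ⟨e (toLex (Sum.inl ⟨k, hμ⟩)), lam_e _, hψ _⟩
    · rintro _ ⟨k, rfl, rfl⟩
      exact ⟨e (toLex (Sum.inr ⟨k, hμ⟩)), lam_e _, hψ _⟩
  · ext p
    constructor
    · rintro (⟨k, hk, rfl⟩ | ⟨k, hk, rfl⟩)
      · refine ⟨e (toLex (Sum.inl ⟨k, hk⟩)), hlam _, ?_⟩
        rw [lam_e, hψ]
        rfl
      · refine ⟨e (toLex (Sum.inr ⟨k, hk⟩)), hlam _, ?_⟩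
        rw [lam_e, hψ]
        rfl
    · rintro ⟨k, hk, rfl⟩
      obtain ⟨i, rfl⟩ := mem_range k hk
      rw [lam_e, hψ]
      rcases i with k | k
      · exact Or.inl ⟨k, k.2, rfl⟩
      · exact Or.inr ⟨k, k.2, rfl⟩

end EigenSequence

/-! ### Covariances of the three fields -/

theorem fieldJ_eq {Ω : Type*} (X : ℕ → unitInterval → Ω → ℝ) (d : ℕ) (t : Fin d → unitInterval) :
    fieldJ X d t = fun ω => (∑ l : Fin d, ∑ j : Fin d, X j (t l) ω) / (d : ℝ) := by
  ext ω
  rw [fieldJ, ← Finset.sum_div, Finset.sum_comm]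

theorem fieldZ_eq {Ω : Type*} (X : ℕ → unitInterval → Ω → ℝ) (d : ℕ) (t : Fin d → unitInterval) :
    fieldZ X d t = fun ω => fieldY X d t ω - fieldJ X d t ω := by
  ext ω
  simp only [fieldZ, fieldY, fieldJ, Finset.sum_sub_distrib]

section Fields

variable {Ω : Type*} [MeasurableSpace Ω] {P : Measure Ω}
  {X : ℕ → unitInterval → Ω → ℝ} {𝒦 : unitInterval → unitInterval → ℝ} {d : ℕ}

theorem memLp_fieldY (hL2 : ∀ j t, MemLp (X j t) 2 P) (t : Fin d → unitInterval) :
    MemLp (fieldY X d t) 2 P :=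
  memLp_finsetSum _ fun j _ => hL2 j (t j)

theorem memLp_sum_process (hL2 : ∀ j t, MemLp (X j t) 2 P) (d : ℕ) (t : unitInterval) :
    MemLp (fun ω => ∑ j : Fin d, X j t ω) 2 P :=
  memLp_finsetSum _ fun j _ => hL2 j t

theorem memLp_fieldJ (hL2 : ∀ j t, MemLp (X j t) 2 P) (t : Fin d → unitInterval) :
    MemLp (fieldJ X d t) 2 P := by
  rw [fieldJ_eq]
  simp_rw [div_eq_mul_inv]
  exact (memLp_finsetSum _ fun l _ => memLp_sum_process hL2 d (t l)).mul_const _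

theorem cov_process (hcov : ∀ j t s, cov[X j t, X j s; P] = 𝒦 t s)
    (huncorr : ∀ j k, j ≠ k → ∀ t s, cov[X j t, X k s; P] = 0) (j k : Fin d)
    (t s : unitInterval) : cov[X j t, X k s; P] = if j = k then 𝒦 t s else 0 := by
  split_ifs with h
  · rw [h, hcov]
  · exact huncorr _ _ (fun h' => h (Fin.ext h')) _ _

variable [IsProbabilityMeasure P]

theorem covFun_fieldY (hL2 : ∀ j t, MemLp (X j t) 2 P)
    (hcov : ∀ j t s, cov[X j t, X j s; P] = 𝒦 t s)
    (huncorr : ∀ j k, j ≠ k → ∀ t s, cov[X j t, X k s; P] = 0) (t s : Fin d → unitInterval) :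
    covFun P (fieldY X d) t s = ∑ j, 𝒦 (t j) (s j) := by
  unfold covFun fieldY
  rw [covariance_fun_sum_fun_sum (fun j : Fin d => hL2 j (t j)) fun j : Fin d => hL2 j (s j)]
  simp [cov_process hcov huncorr]

/-- `J` averages the values at the `t_l` of the single process `∑ X_j`, whose covariance is `d 𝒦`;
the factor is `d / d² = 1 / d`. -/
theorem covFun_fieldJ (hd : d ≠ 0) (hL2 : ∀ j t, MemLp (X j t) 2 P)
    (hcov : ∀ j t s, cov[X j t, X j s; P] = 𝒦 t s)
    (huncorr : ∀ j k, j ≠ k → ∀ t s, cov[X j t, X k s; P] = 0) (t s : Fin d → unitInterval) :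
    covFun P (fieldJ X d) t s = (∑ l, ∑ m, 𝒦 (t l) (s m)) / d := by
  have h : ∀ x y : unitInterval,
      cov[fun ω => ∑ j : Fin d, X j x ω, fun ω => ∑ j : Fin d, X j y ω; P] = d * 𝒦 x y := by
    intro x y
    rw [covariance_fun_sum_fun_sum (fun j : Fin d => hL2 j x) fun j : Fin d => hL2 j y]
    simp [cov_process hcov huncorr]
  rw [covFun, fieldJ_eq, fieldJ_eq, covariance_fun_div_left, covariance_fun_div_right,
    covariance_fun_sum_fun_sum (fun l => memLp_sum_process hL2 d (t l))
      fun l => memLp_sum_process hL2 d (s l)]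
  simp only [h, ← Finset.mul_sum]
  field_simp

theorem cov_fieldY_fieldJ (hL2 : ∀ j t, MemLp (X j t) 2 P)
    (hcov : ∀ j t s, cov[X j t, X j s; P] = 𝒦 t s)
    (huncorr : ∀ j k, j ≠ k → ∀ t s, cov[X j t, X k s; P] = 0) (t s : Fin d → unitInterval) :
    cov[fieldY X d t, fieldJ X d s; P] = (∑ l, ∑ m, 𝒦 (t l) (s m)) / d := by
  have h : ∀ (j : Fin d) (x y : unitInterval),
      cov[X j x, fun ω => ∑ k : Fin d, X k y ω; P] = 𝒦 x y := by
    intro j x y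
    rw [covariance_fun_sum_right (fun k : Fin d => hL2 k y) (hL2 j x)]
    simp [cov_process hcov huncorr]
  unfold fieldY
  rw [fieldJ_eq, covariance_fun_div_right,
    covariance_fun_sum_fun_sum (fun j : Fin d => hL2 j (t j))
      fun l => memLp_sum_process hL2 d (s l)]
  simp only [h]

theorem covFun_fieldZ (hd : d ≠ 0) (hL2 : ∀ j t, MemLp (X j t) 2 P)
    (hcov : ∀ j t s, cov[X j t, X j s; P] = 𝒦 t s)
    (huncorr : ∀ j k, j ≠ k → ∀ t s, cov[X j t, X k s; P] = 0) (t s : Fin d → unitInterval) :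
    covFun P (fieldZ X d) t s = ∑ j, 𝒦 (t j) (s j) - (∑ l, ∑ m, 𝒦 (t l) (s m)) / d := by
  have hsymm : ∀ x y, 𝒦 x y = 𝒦 y x := fun x y => by
    rw [← hcov 0, ← hcov 0, covariance_comm]
  have hJY : cov[fieldJ X d t, fieldY X d s; P] = (∑ l, ∑ m, 𝒦 (t l) (s m)) / d := by
    rw [covariance_comm, cov_fieldY_fieldJ hL2 hcov huncorr, Finset.sum_comm]
    simp only [hsymm]
  have hY := covFun_fieldY (d := d) hL2 hcov huncorr t s
  have hJ := covFun_fieldJ hd hL2 hcov huncorr t s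
  rw [covFun] at hY hJ
  rw [covFun, fieldZ_eq, fieldZ_eq, covariance_fun_sub_fun_sub (memLp_fieldY hL2 t)
    (memLp_fieldJ hL2 t) (memLp_fieldY hL2 s) (memLp_fieldJ hL2 s), hY, hJ, hJY,
    cov_fieldY_fieldJ hL2 hcov huncorr]
  ring

end Fields

/-! ### Orthogonality by permuting coordinates -/

theorem integral_comp_perm {d : ℕ} (σ : Equiv.Perm (Fin d))
    (g : (Fin d → unitInterval) → ℝ) : ∫ u, g (u ∘ σ) = ∫ u, g u := by
  rw [← (volume_measurePreserving_piCongrLeft (fun _ : Fin d => unitInterval) σ.symm).integral_comp'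
    g]
  refine integral_congr_ae (.of_forall fun u => ?_)
  refine congrArg g (funext fun i => ?_)
  obtain ⟨j, rfl⟩ := σ.symm.surjective i
  rw [MeasurableEquiv.coe_piCongrLeft, Equiv.piCongrLeft_apply_apply]
  simp

/-- Against a symmetric sum, the diagonal sum `∑ j, f j (u j)` integrates like its average over
all pairs of indices. -/
theorem integral_diagonal_sub_average_mul_eq_zero {d : ℕ} (hd : d ≠ 0)
    {f : Fin d → unitInterval → ℝ} (hf : ∀ j, Continuous (f j)) {g : unitInterval → ℝ}
    (hg : Continuous g) :
    ∫ u : Fin d → unitInterval,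
      (∑ j, f j (u j) - (∑ j, ∑ m, f j (u m)) / d) * ∑ m, g (u m) = 0 := by
  -- Swapping coordinates `j` and `m` fixes the symmetric sum, so the integral does not depend on
  -- `m`; averaging over the `d` values of `m` returns the diagonal term.
  have hperm : ∀ j m, ∫ u : Fin d → unitInterval, f j (u m) * ∑ l, g (u l)
      = ∫ u : Fin d → unitInterval, f j (u j) * ∑ l, g (u l) := fun j m => by
    rw [← integral_comp_perm (Equiv.swap j m)]
    refine integral_congr_ae (.of_forall fun u => ?_)
    simp [Equiv.sum_comp (Equiv.swap j m) fun l => g (u l)]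
  have hint : ∀ j m, Integrable fun u : Fin d → unitInterval => f j (u m) * ∑ l, g (u l) :=
    fun j m => Continuous.integrable_of_hasCompactSupport
      (((hf j).comp (continuous_apply m)).mul (continuous_finsetSum _ fun l _ =>
        hg.comp (continuous_apply l))) (HasCompactSupport.of_compactSpace _)
  have hexp : ∀ u : Fin d → unitInterval,
      (∑ j, f j (u j) - (∑ j, ∑ m, f j (u m)) / d) * ∑ m, g (u m)
        = ∑ j, f j (u j) * ∑ l, g (u l) - (∑ j, ∑ m, f j (u m) * ∑ l, g (u l)) / d := fun u => by
    rw [sub_mul, div_mul_eq_mul_div, Finset.sum_mul, Finset.sum_mul]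
    simp only [Finset.sum_mul]
  simp only [hexp]
  rw [integral_sub (integrable_finsetSum _ fun j _ => hint j j)
      ((integrable_finsetSum _ fun j _ => integrable_finsetSum _ fun m _ => hint j m).div_const _),
    integral_div, integral_finsetSum _ fun j _ => hint j j,
    integral_finsetSum _ fun j _ => integrable_finsetSum _ fun m _ => hint j m]
  simp only [integral_finsetSum _ fun m _ => hint _ m, hperm, Finset.sum_const, Finset.card_univ,
    Fintype.card_fin, nsmul_eq_mul, ← Finset.mul_sum]
  field_simp
  ring

theorem proposition3 {Ω : Type*} [MeasurableSpace Ω] (P : Measure Ω) [IsProbabilityMeasure P]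
    (X : ℕ → unitInterval → Ω → ℝ) (𝒦 : unitInterval → unitInterval → ℝ)
    (hL2 : ∀ j t, MemLp (X j t) 2 P)
    (hmean : ∀ j t, ∫ ω, X j t ω ∂P = 0)
    (hcont : Continuous (Function.uncurry 𝒦))
    (hcov : ∀ j t s, cov[X j t, X j s; P] = 𝒦 t s)
    (huncorr : ∀ j k, j ≠ k → ∀ t s, cov[X j t, X k s; P] = 0)
    (d : ℕ) (hd : 1 ≤ d)
    (SJ SZ : Set (ℝ × L2Cube d))
    (hSJ : IsEigenpairSet P (fieldJ X d) SJ) (hSZ : IsEigenpairSet P (fieldZ X d) SZ) :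
    SJ ∩ SZ = ∅ ∧ IsEigenpairSet P (fieldY X d) (SJ ∪ SZ) := by
  have hd0 : d ≠ 0 := Nat.one_le_iff_ne_zero.1 hd
  have hcomp : ∀ l m : Fin d, Continuous
      fun p : (Fin d → unitInterval) × (Fin d → unitInterval) => 𝒦 (p.1 l) (p.2 m) := fun l m =>
    hcont.comp (g := Function.uncurry 𝒦)
      (f := fun p : (Fin d → unitInterval) × (Fin d → unitInterval) => (p.1 l, p.2 m))
      (by fun_prop)
  have hJcont : Continuous fun p : (Fin d → unitInterval) × (Fin d → unitInterval) =>
      (∑ l, ∑ m, 𝒦 (p.1 l) (p.2 m)) / (d : ℝ) :=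
    (continuous_finsetSum _ fun l _ => continuous_finsetSum _ fun m _ => hcomp l m).div_const _
  let KJ : C((Fin d → unitInterval) × (Fin d → unitInterval), ℝ) := ⟨_, hJcont⟩
  let KZ : C((Fin d → unitInterval) × (Fin d → unitInterval), ℝ) :=
    ⟨_, (continuous_finsetSum Finset.univ fun j _ => hcomp j j).sub hJcont⟩
  have hJ : ∀ t s, covFun P (fieldJ X d) t s = KJ (t, s) := covFun_fieldJ hd0 hL2 hcov huncorr
  have hZ : ∀ t s, covFun P (fieldZ X d) t s = KZ (t, s) := covFun_fieldZ hd0 hL2 hcov huncorr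
  have hY : ∀ t s, covFun P (fieldY X d) t s = KJ (t, s) + KZ (t, s) := fun t s =>
    (covFun_fieldY hL2 hcov huncorr t s).trans (add_sub_cancel _ _).symm
  have hJsymm : ∀ t s, KJ (t, s) = KJ (s, t) := fun t s => by
    rw [← hJ, ← hJ, covFun, covFun, covariance_comm]
  have hZsymm : ∀ t s, KZ (t, s) = KZ (s, t) := fun t s => by
    rw [← hZ, ← hZ, covFun, covFun, covariance_comm]
  have horth : ∀ s t, ∫ u, KZ (s, u) * KJ (t, u) = 0 := fun s t => by
    rw [← integral_diagonal_sub_average_mul_eq_zero hd0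
      (f := fun j x => 𝒦 (s j) x)
      (fun j => hcont.comp (g := Function.uncurry 𝒦) (Continuous.prodMk_right (s j)))
      (g := fun x => (∑ l, 𝒦 (t l) x) / d) ((continuous_finsetSum _ fun l _ =>
        hcont.comp (g := Function.uncurry 𝒦) (Continuous.prodMk_right (t l))).div_const _)]
    refine integral_congr_ae (.of_forall fun u => ?_)
    change _ * ((∑ l, ∑ m, 𝒦 (t l) (u m)) / (d : ℝ)) = _
    rw [Finset.sum_comm, Finset.sum_div]
    rfl
  refine isEigenpairSet_union_of_kernelOp_comp_eq_zero hJ hZ hY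
    (kernelOp_comp_eq_zero hZsymm horth) (kernelOp_comp_eq_zero hJsymm fun s t => ?_) hSJ hSZ
  rw [← horth t s]
  simp only [mul_comm]
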